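/- Work over $\mathbb{C}$, and let $\mathbb{P}^k$ denote complex projective $k$-space. Let $n\ge 1$. A camera is a complex matrix of full rank (i.e. of rank $\min(h+1,N+1)$ if its size is $(h+1)\times(N+1)$). For cameras $\mathbf{C}=(C_1,\dots,C_n)$, all of size $(h+1)\times (N+1)$, let $c_i=\mathbb{P}(\ker C_i)\subseteq\mathbb{P}^N$ be the center of $C_i$, let $c_I=\bigcap_{i\in I}c_i$ for nonempty $I\subseteq\{1,\dots,n\}$, and let $\mathcal{M}_{\mathbf{C}}^{N,h}\subseteq(\mathbb{P}^h)^n$ be the Zariski closure of the image of the rational map $$\mathbb{P}^N\dashrightarrow(\mathbb{P}^h)^n,\qquad X\mapsto(C_1X,\dots,C_nX),$$ which is defined at the points $X$ lying in no center. Ranks of matrices built from $x=(x_1,\dots,x_n)\in(\mathbb{P}^h)^n$ are computed with arbitrary nonzero representatives $x_i\in\mathbb{C}^{h+1}$. **Theorem.** (P1) Let $N\ge 0$ and let all $C_i$ be of size $(N+1)\times(N+1)$. Then $$\mathcal{M}_{\mathbf{C}}^{N,N}=\{x\in(\mathbb{P}^N)^n:\ \operatorname{rank}\,[\,C_1^{-1}x_1\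 \cdots\ C_n^{-1}x_n\,]\le 1\}.$$ (P2) Let $N\ge 2$, let all $C_i$ be of size $N\times(N+1)$, and put $$M_{\mathbf{C}}(x)=\begin{bmatrix}C_1&x_1&0&\cdots&0\\ C_2&0&x_2&\cdots&0\\ \vdots&\vdots&\vdots&\ddots&\vdots\\ C_n&0&0&\cdots&x_n\end{bmatrix}.$$ Then $$\mathcal{M}_{\mathbf{C}}^{N,N-1}=\{x\in(\mathbb{P}^{N-1})^n:\ \operatorname{rank} M_{\mathbf{C}}(x)\le N+n\}$$ if and only if the centers $c_1,\dots,c_n$ are pairwise distinct. For $N=1$ this equality holds for all cameras $C_1,\dots,C_n$ of size $1\times 2$. (P3) Let $N\ge 0$, let all $C_i$ be of size $2\times(N+1)$, and write $\widetilde{x}=\begin{bmatrix}0&1\\-1&0\end{bmatrix}x$ for $x\in\mathbb{C}^2$. Then $$\mathcal{M}_{\mathbf{C}}^{N,1}=\{x\in(\mathbb{P}^1)^n:\ \operatorname{rank}\,[\,C_1^{T}\widetilde{x}_1\ \cdots\ C_n^{T}\widetilde{x}_n\,]\le N\}$$ if and only if for every nonempty $I\subseteq\{1,\dots,n\}$ with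 $c_I\ne\emptyset$ we have $N-|I|-1\ge\dim c_I$ (projective dimension). -/

import Mathlib

/-- The projective space `ℙ(ℂ^r) = ℙ^(r-1)` of lines through the origin of `ℂ^r`. -/
abbrev ProjSpace (r : ℕ) : Type := Projectivization ℂ (Fin r → ℂ)

/-- A camera `ℙ^(s-1) ⇢ ℙ^(r-1)`: an `r × s` complex matrix of full rank. -/
def IsCamera {r s : ℕ} (C : Matrix (Fin r) (Fin s) ℂ) : Prop :=
  C.rank = min r s

/-- The center of a camera, given by the linear subspace `ker C` of `ℂ^s`
(the projective subspace is the set of points lying in it; it is empty iff `ker C = ⊥`). -/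
def center {r s : ℕ} (C : Matrix (Fin r) (Fin s) ℂ) : Submodule ℂ (Fin s → ℂ) :=
  LinearMap.ker C.mulVecLin

/-- The intersection `c_I` of the centers of the cameras `C_i`, `i ∈ I`. -/
def centerInter {n r s : ℕ} (C : Fin n → Matrix (Fin r) (Fin s) ℂ) (I : Finset (Fin n)) :
    Submodule ℂ (Fin s → ℂ) :=
  ⨅ i ∈ I, center (C i)

/-- The dimension of the projective subspace given by a linear subspace. -/
noncomputable def projDim {s : ℕ} (W : Submodule ℂ (Fin s → ℂ)) : ℤ :=
  (Module.finrank ℂ W : ℤ) - 1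

/-- `φ`, a polynomial in `n` groups of `r` variables, is homogeneous of degree `d i` in the
`i`-th group of variables, for each `i`. -/
def IsMultihomogeneous {n r : ℕ} (φ : MvPolynomial (Fin n × Fin r) ℂ) (d : Fin n → ℕ) : Prop :=
  MvPolynomial.IsWeightedHomogeneous (fun p : Fin n × Fin r => (Pi.single p.1 1 : Fin n → ℕ)) φ d

/-- `φ` vanishes at the point `x` of `(ℙ^(r-1))^n`. For multihomogeneous `φ` this does not depend
on the representatives, see `vanishesAt_iff`. -/
noncomputable def VanishesAt {n r : ℕ} (φ : MvPolynomial (Fin n × Fin r) ℂ)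
    (x : Fin n → ProjSpace r) : Prop :=
  MvPolynomial.eval (fun p => (x p.1).rep p.2) φ = 0

theorem IsMultihomogeneous.eval_smul {n r : ℕ} {φ : MvPolynomial (Fin n × Fin r) ℂ}
    {d : Fin n → ℕ} (h : IsMultihomogeneous φ d) (t : Fin n → ℂ) (v : Fin n → Fin r → ℂ) :
    MvPolynomial.eval (fun p => t p.1 * v p.1 p.2) φ =
      (∏ i, t i ^ d i) * MvPolynomial.eval (fun p => v p.1 p.2) φ := by
  rw [MvPolynomial.eval_eq, MvPolynomial.eval_eq, Finset.mul_sum]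
  refine Finset.sum_congr rfl fun e he => ?_
  have hd := h (MvPolynomial.mem_support_iff.mp he)
  have key : ∏ p ∈ e.support, t p.1 ^ e p = ∏ i, t i ^ d i := by
    rw [← hd, Finsupp.weight_apply, Finsupp.sum]
    simp only [Finset.sum_apply, Pi.smul_apply, Pi.single_apply, smul_eq_mul, mul_ite, mul_one,
      mul_zero]
    simp only [← Finset.prod_pow_eq_pow_sum]
    rw [Finset.prod_comm]
    refine Finset.prod_congr rfl fun p _ => ?_
    rw [Finset.prod_eq_single p.1]
    · simp
    · intro i _ hi
      simp [hi]
    · simp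
  simp only [mul_pow, Finset.prod_mul_distrib, key]
  ring

theorem vanishesAt_iff {n r : ℕ} {φ : MvPolynomial (Fin n × Fin r) ℂ} {d : Fin n → ℕ}
    (h : IsMultihomogeneous φ d) (v : Fin n → Fin r → ℂ) (hv : ∀ i, v i ≠ 0) :
    VanishesAt φ (fun i => Projectivization.mk ℂ (v i) (hv i)) ↔
      MvPolynomial.eval (fun p => v p.1 p.2) φ = 0 := by
  choose a ha using fun i => Projectivization.exists_smul_eq_mk_rep ℂ (v i) (hv i)
  have hr : (fun p : Fin n × Fin r => (Projectivization.mk ℂ (v p.1) (hv p.1)).rep p.2) =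
      fun p => (a p.1 : ℂ) * v p.1 p.2 := by
    funext p
    rw [← ha p.1]
    rfl
  rw [VanishesAt, hr, h.eval_smul (fun i => (a i : ℂ)) v, mul_eq_zero]
  refine or_iff_right ?_
  exact Finset.prod_ne_zero_iff.mpr fun i _ => pow_ne_zero _ (a i).ne_zero

/-- The Zariski closure of a subset of `(ℙ^(r-1))^n`: the common zeros of all multihomogeneous
polynomials that vanish on it. -/
def zariskiClosure {n r : ℕ} (S : Set (Fin n → ProjSpace r)) : Set (Fin n → ProjSpace r) :=
  {x | ∀ (φ : MvPolynomial (Fin n × Fin r) ℂ) (d : Fin n → ℕ), IsMultihomogeneous φ d →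
    (∀ y ∈ S, VanishesAt φ y) → VanishesAt φ x}

/-- The image of the rational map `X ↦ (C_1 X, …, C_n X)`, which is defined at the points `X` that
lie in no center. -/
def jointImage {n r s : ℕ} (C : Fin n → Matrix (Fin r) (Fin s) ℂ) :
    Set (Fin n → ProjSpace r) :=
  {x | ∃ X : ProjSpace s, ∀ i, ∃ h : (C i).mulVec X.rep ≠ 0,
    x i = Projectivization.mk ℂ ((C i).mulVec X.rep) h}

/-- The point multiview variety of the camera arrangement `C`. -/
def multiviewVariety {n r s : ℕ} (C : Fin n → Matrix (Fin r) (Fin s) ℂ) :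
    Set (Fin n → ProjSpace r) :=
  zariskiClosure (jointImage C)

/-- The matrix `[C_1⁻¹ x_1 ⋯ C_n⁻¹ x_n]`. -/
noncomputable def invMatrix {n s : ℕ} (C : Fin n → Matrix (Fin s) (Fin s) ℂ)
    (x : Fin n → Fin s → ℂ) : Matrix (Fin s) (Fin n) ℂ :=
  Matrix.of fun j i => ((C i)⁻¹).mulVec (x i) j

/-- The block matrix whose `i`-th block of rows is `[C_i 0 ⋯ x_i ⋯ 0]`, with `x_i` in the `i`-th of
the last `n` columns. -/
def blockMatrix {n r s : ℕ} (C : Fin n → Matrix (Fin r) (Fin s) ℂ) (x : Fin n → Fin r → ℂ) :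
    Matrix (Fin n × Fin r) (Fin s ⊕ Fin n) ℂ :=
  Matrix.of fun p q =>
    Sum.elim (fun j => C p.1 p.2 j) (fun k => if k = p.1 then x p.1 p.2 else 0) q

/-- The matrix `[C_1ᵀ x̃_1 ⋯ C_nᵀ x̃_n]`, where `x̃ = [0 1; -1 0] x`. -/
def backMatrix {n s : ℕ} (C : Fin n → Matrix (Fin 2) (Fin s) ℂ) (x : Fin n → Fin 2 → ℂ) :
    Matrix (Fin s) (Fin n) ℂ :=
  Matrix.of fun j i => (C i).transpose.mulVec ((!![0, 1; -1, 0] : Matrix _ _ ℂ).mulVec (x i)) j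

/-!
In all three cases the rank condition says that `x` lies in the set `V` of the points for which some
`X ≠ 0` has every `C_i X`, possibly zero, in the line `ℂ x_i`: in the first case `X` spans the
column space, in the second the last `n` coordinates of a kernel vector of the block matrix are the
negatives of the proportionality factors, and in the third `C_iᵀ x̃_i` is the functional
`X ↦ det(C_i X, x_i)`. So the question is when the closure of the joint image is `V`.

* The closure satisfies a stronger condition
  (`exists_notMem_centerInter_of_mem_multiviewVariety`): for each nonempty set `I` of cameras there
  is `Y` outside `c_I` with `C_i Y ∈ ℂ x_i` for all `i ∈ I`. This is a condition on minors of a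
  matrix with multihomogeneous entries. With `I` the set of all cameras it puts the closure
  inside `V`.
* Conversely `V` is contained in the closure if every degenerate `X` can be moved in a direction `Y`
  that is compatible with the lines `ℂ x_i` of the cameras killing `X` and is not killed by all of
  them (`eval_eq_zero_of_mulVec_mem_span`, `multiviewVariety_eq`). For invertible cameras no `X` is
  degenerate. For cameras `N × (N + 1)` with distinct centers only one camera kills `X`, and it is
  surjective. For cameras `2 × (N + 1)` the vectors `Y` with `C_i Y ∈ ℂ x_i` for all `i ∈ I` form a
  space of dimension at least `N + 1 - |I|`, more than the linear dimension of `c_I` by hypothesis.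
* If the condition on the centers fails, then for a suitable `I` the points of `V` coming from
  `X ∈ c_I` have arbitrary coordinates `x_i`, `i ∈ I`, and these can be chosen such that no `Y`
  outside `c_I` is compatible with them. For two equal centers this is immediate. For cameras
  `2 × (N + 1)` one takes a minimal violating `I`; then the choice is an independent transversal in
  the sense of Rado's theorem (`exists_finrank_inf_iInf_comap_add_card_le`).

For cameras `1 × 2` both sets are the one-point space `(ℙ^0)^n`.
-/

open Matrix
open scoped Topology

/-! ### Collinear vectors and minors -/

theorem mem_span_singleton_iff_mul_eq_mul {ι : Type*} {v : ι → ℂ} (hv : v ≠ 0) (u : ι → ℂ) :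
    u ∈ Submodule.span ℂ {v} ↔ ∀ a b, v a * u b = v b * u a := by
  rw [Submodule.mem_span_singleton]
  constructor
  · rintro ⟨c, rfl⟩ a b
    simp only [Pi.smul_apply, smul_eq_mul]
    ring
  · intro h
    obtain ⟨a, ha⟩ := Function.ne_iff.mp hv
    refine ⟨(v a)⁻¹ * u a, funext fun b => ?_⟩
    have ha' : v a ≠ 0 := ha
    have := h a b
    simp only [Pi.smul_apply, smul_eq_mul]
    field_simp
    linear_combination -this

theorem exists_ne_zero_smul_of_mem_span_singleton {V : Type*} [AddCommGroup V] [Module ℂ V]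
    {u v : V} (h : u ∈ Submodule.span ℂ {v}) (hu : u ≠ 0) : ∃ c : ℂ, c ≠ 0 ∧ u = c • v := by
  obtain ⟨c, rfl⟩ := Submodule.mem_span_singleton.mp h
  exact ⟨c, fun hc => hu (by simp [hc]), rfl⟩

theorem mem_span_singleton_symm {V : Type*} [AddCommGroup V] [Module ℂ V]
    {u v : V} (h : u ∈ Submodule.span ℂ {v}) (hu : u ≠ 0) : v ∈ Submodule.span ℂ {u} := by
  obtain ⟨c, hc, rfl⟩ := exists_ne_zero_smul_of_mem_span_singleton h hu
  exact Submodule.mem_span_singleton.mpr ⟨c⁻¹, by simp [smul_smul, hc]⟩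

theorem Matrix.exists_det_submatrix_ne_zero {K m : Type*} [Field K] [Finite m] {d : ℕ}
    (M : Matrix m (Fin d) K) (hM : ∀ c, M *ᵥ c = 0 → c = 0) :
    ∃ f : Fin d → m, (M.submatrix f id).det ≠ 0 := by
  cases nonempty_fintype m
  have hr : Module.finrank K (Submodule.span K (Set.range M.row)) = d := by
    rw [← M.rank_eq_finrank_span_row, Matrix.rank,
      LinearMap.finrank_range_of_inj (LinearMap.ker_eq_bot.mp ?_), Module.finrank_fin_fun]
    exact LinearMap.ker_eq_bot'.mpr hM
  obtain ⟨κ, a, ha, hspan, hli⟩ := exists_linearIndependent' K M.row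
  have : Finite κ := Finite.of_injective a ha
  cases nonempty_fintype κ
  have hcard : Fintype.card κ = d := by
    rw [← hr, ← hspan, finrank_span_eq_card hli]
  let e : Fin d ≃ κ := (Fintype.equivFinOfCardEq hcard).symm
  refine ⟨a ∘ e, ?_⟩
  have hli' : LinearIndependent K (M.submatrix (a ∘ e) id).row :=
    hli.comp e e.injective
  exact ((Matrix.isUnit_iff_isUnit_det _).mp
    (Matrix.linearIndependent_rows_iff_isUnit.mp hli')).ne_zero

theorem Matrix.rank_lt_card_iff {K m k : Type*} [Field K] [Fintype k]
    (M : Matrix m k K) : M.rank < Fintype.card k ↔ ∃ v ≠ 0, M *ᵥ v = 0 := by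
  have h := M.mulVecLin.finrank_range_add_finrank_ker
  rw [Module.finrank_fintype_fun_eq_card] at h
  change M.rank + _ = _ at h
  have h2 : (∃ v ≠ 0, M *ᵥ v = 0) ↔ LinearMap.ker M.mulVecLin ≠ ⊥ := by
    rw [Submodule.ne_bot_iff]
    simp only [LinearMap.mem_ker, Matrix.mulVecLin_apply]
    exact exists_congr fun v => and_comm
  rw [h2, ← Submodule.one_le_finrank_iff]
  omega

/-! ### The joint image and its closure -/

theorem mem_center {r s : ℕ} {C : Matrix (Fin r) (Fin s) ℂ} {X : Fin s → ℂ} :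
    X ∈ center C ↔ C *ᵥ X = 0 := by
  simp [center]

theorem mem_centerInter {n r s : ℕ} {C : Fin n → Matrix (Fin r) (Fin s) ℂ} {I : Finset (Fin n)}
    {X : Fin s → ℂ} : X ∈ centerInter C I ↔ ∀ i ∈ I, C i *ᵥ X = 0 := by
  simp [centerInter, Submodule.mem_iInf, mem_center]

theorem mk_mem_jointImage {n r s : ℕ} {C : Fin n → Matrix (Fin r) (Fin s) ℂ}
    {X : Fin s → ℂ} (hX : X ≠ 0) {v : Fin n → Fin r → ℂ} (hv : ∀ i, v i ≠ 0)
    (hC : ∀ i, C i *ᵥ X ≠ 0) (h : ∀ i, C i *ᵥ X ∈ Submodule.span ℂ {v i}) :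
    (fun i => Projectivization.mk ℂ (v i) (hv i)) ∈ jointImage C := by
  obtain ⟨a, ha⟩ := Projectivization.exists_smul_eq_mk_rep ℂ X hX
  have hrep : ∀ i, C i *ᵥ (Projectivization.mk ℂ X hX).rep = (a : ℂ) • C i *ᵥ X := fun i => by
    rw [← ha, Units.smul_def, Matrix.mulVec_smul]
  refine ⟨Projectivization.mk ℂ X hX, fun i => ⟨?_, ?_⟩⟩
  · rw [hrep]
    exact smul_ne_zero a.ne_zero (hC i)
  · obtain ⟨c, -, hc⟩ := exists_ne_zero_smul_of_mem_span_singleton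
      (mem_span_singleton_symm (h i) (hC i)) (hv i)
    rw [Projectivization.mk_eq_mk_iff']
    refine ⟨c * (a : ℂ)⁻¹, ?_⟩
    rw [hrep, hc, smul_smul, mul_assoc, inv_mul_cancel₀ a.ne_zero, mul_one]

theorem exists_of_mem_jointImage {n r s : ℕ} {C : Fin n → Matrix (Fin r) (Fin s) ℂ}
    {x : Fin n → ProjSpace r} (hx : x ∈ jointImage C) :
    ∃ X : Fin s → ℂ, (∀ i, C i *ᵥ X ≠ 0) ∧ ∀ i, C i *ᵥ X ∈ Submodule.span ℂ {(x i).rep} := by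
  obtain ⟨X, hX⟩ := hx
  choose h hxi using hX
  refine ⟨X.rep, h, fun i => ?_⟩
  obtain ⟨a, ha⟩ := Projectivization.exists_smul_eq_mk_rep ℂ _ (h i)
  rw [hxi i, ← ha]
  exact Submodule.mem_span_singleton.mpr ⟨((a⁻¹ : ℂˣ) : ℂ), by simp [Units.smul_def, smul_smul]⟩

/-- For vectors `u k i` in `ℂ^r`, the matrix over the multihomogeneous coordinate ring of
`(ℙ^(r-1))^n` whose rows, indexed by `(i, a, b)` with `i ∈ I`, are the `2 × 2` minors of the pairs
`(x_i, u k i)`: its kernel at the point `x` consists of the `c` such that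
`∑ k, c k • u k i` is a multiple of `x_i` for all `i ∈ I`. Rows with `a = b` are zero. -/
noncomputable def collinearityMatrix {n r d : ℕ} (I : Finset (Fin n))
    (u : Fin d → Fin n → Fin r → ℂ) :
    Matrix (I × Fin r × Fin r) (Fin d) (MvPolynomial (Fin n × Fin r) ℂ) :=
  Matrix.of fun p k =>
    MvPolynomial.X (p.1.1, p.2.1) * MvPolynomial.C (u k p.1 p.2.2) -
      MvPolynomial.X (p.1.1, p.2.2) * MvPolynomial.C (u k p.1 p.2.1)

theorem isMultihomogeneous_collinearityMatrix {n r d : ℕ} {I : Finset (Fin n)}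
    (u : Fin d → Fin n → Fin r → ℂ) (p : I × Fin r × Fin r) (k : Fin d) :
    IsMultihomogeneous (collinearityMatrix I u p k) (Pi.single p.1.1 1) := by
  have key : ∀ (a : Fin r) (c : ℂ), IsMultihomogeneous
      (MvPolynomial.X (p.1.1, a) * MvPolynomial.C c) (Pi.single p.1.1 1) := fun a c => by
    have h1 := MvPolynomial.isWeightedHomogeneous_X ℂ
      (fun p : Fin n × Fin r => (Pi.single p.1 1 : Fin n → ℕ)) (p.1.1, a)
    have h2 := MvPolynomial.isWeightedHomogeneous_C
      (fun p : Fin n × Fin r => (Pi.single p.1 1 : Fin n → ℕ)) c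
    simpa [IsMultihomogeneous] using h1.mul h2
  exact Submodule.sub_mem (MvPolynomial.weightedHomogeneousSubmodule ℂ _ _) (key _ _) (key _ _)

theorem isMultihomogeneous_det {n r d : ℕ}
    (M : Matrix (Fin d) (Fin d) (MvPolynomial (Fin n × Fin r) ℂ)) (w : Fin d → Fin n → ℕ)
    (hM : ∀ i j, IsMultihomogeneous (M i j) (w i)) : IsMultihomogeneous M.det (∑ i, w i) := by
  rw [Matrix.det_apply]
  refine Submodule.sum_mem (MvPolynomial.weightedHomogeneousSubmodule ℂ _ _) fun σ _ => ?_
  have h := MvPolynomial.IsWeightedHomogeneous.prod Finset.univ (fun i => M (σ i) i)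
    (fun i => w (σ i)) (fun i _ => hM (σ i) i)
  rw [Equiv.sum_comp σ w] at h
  rw [Units.smul_def]
  exact Submodule.smul_of_tower_mem (MvPolynomial.weightedHomogeneousSubmodule ℂ _ _) _ h

theorem map_eval_collinearityMatrix_mulVec {n r s d : ℕ} (C : Fin n → Matrix (Fin r) (Fin s) ℂ)
    (I : Finset (Fin n)) (b : Fin d → Fin s → ℂ) (v : Fin n → Fin r → ℂ) (c : Fin d → ℂ)
    (p : I × Fin r × Fin r) :
    ((collinearityMatrix I fun k i => C i *ᵥ b k).map
      (MvPolynomial.eval fun p => v p.1 p.2) *ᵥ c) p =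
      v p.1 p.2.1 * (C p.1 *ᵥ ∑ k, c k • b k) p.2.2 -
        v p.1 p.2.2 * (C p.1 *ᵥ ∑ k, c k • b k) p.2.1 := by
  rw [Matrix.mulVec_sum]
  simp only [Matrix.mulVec_smul, Finset.sum_apply, Pi.smul_apply, smul_eq_mul, Finset.mul_sum,
    ← Finset.sum_sub_distrib]
  simp only [Matrix.mulVec, dotProduct, Matrix.map_apply, collinearityMatrix, Matrix.of_apply,
    map_sub, map_mul, MvPolynomial.eval_X, MvPolynomial.eval_C]
  exact Finset.sum_congr rfl fun k _ => by ring

/-- The points `x` for which some `Y` outside `c_I` is mapped by each `C_i`, `i ∈ I`, to a multiple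
of `x_i` satisfy the closed condition that a system of linear equations for the class of `Y` in
`ℂ^s / c_I` is singular; this closed set contains the joint image. -/
theorem exists_notMem_centerInter_of_mem_multiviewVariety {n r s : ℕ}
    {C : Fin n → Matrix (Fin r) (Fin s) ℂ} {x : Fin n → ProjSpace r}
    (hx : x ∈ multiviewVariety C) {I : Finset (Fin n)} (hI : I.Nonempty) :
    ∃ Y ∉ centerInter C I, ∀ i ∈ I, C i *ᵥ Y ∈ Submodule.span ℂ {(x i).rep} := by
  by_contra! hcon
  obtain ⟨W, hW⟩ := Submodule.exists_isCompl (centerInter C I)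
  let b := Module.finBasis ℂ W
  let u : Fin (Module.finrank ℂ W) → Fin n → Fin r → ℂ := fun k i => C i *ᵥ (b k : Fin s → ℂ)
  have hsum : ∀ c : Fin (Module.finrank ℂ W) → ℂ,
      ∑ k, c k • (b k : Fin s → ℂ) = (∑ k, c k • b k : W) := fun c => by simp
  let M := (collinearityMatrix I u).map (MvPolynomial.eval fun p => (x p.1).rep p.2)
  obtain ⟨f, hf⟩ := M.exists_det_submatrix_ne_zero fun c hc => by
    have hmem : ∑ k, c k • (b k : Fin s → ℂ) ∈ centerInter C I := by
      by_contra hY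
      obtain ⟨i, hi, hni⟩ := hcon _ hY
      refine hni ((mem_span_singleton_iff_mul_eq_mul (x i).rep_nonzero _).mpr fun a a' => ?_)
      have := congrFun hc (⟨i, hi⟩, a, a')
      rw [map_eval_collinearityMatrix_mulVec C I (fun k => (b k : Fin s → ℂ))
        (fun i => (x i).rep)] at this
      exact sub_eq_zero.mp this
    have h0 : (∑ k, c k • b k : W) = 0 := by
      rw [hsum] at hmem
      exact Subtype.ext ((Submodule.disjoint_def.mp hW.disjoint) _ hmem (Subtype.prop _))
    exact funext fun k => Fintype.linearIndependent_iff.mp b.linearIndependent c h0 k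
  have heval : ∀ v : Fin n × Fin r → ℂ,
      MvPolynomial.eval v ((collinearityMatrix I u).submatrix f id).det =
        (((collinearityMatrix I u).map (MvPolynomial.eval v)).submatrix f id).det := fun v => by
    rw [RingHom.map_det]
    rfl
  refine hf ((heval _).symm.trans (hx _ _ (isMultihomogeneous_det _ _ fun i j =>
    isMultihomogeneous_collinearityMatrix u (f i) j) fun y hy => ?_))
  obtain ⟨X, hX0, hX⟩ := exists_of_mem_jointImage hy
  -- The component of `X` in `W` gives a kernel vector; it is nonzero since `C i *ᵥ X ≠ 0`, `i ∈ I`.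
  obtain ⟨z, hz, w, hw, rfl⟩ : ∃ z ∈ centerInter C I, ∃ w ∈ W, z + w = X :=
    Submodule.mem_sup.mp (hW.sup_eq_top ▸ Submodule.mem_top)
  have hzw : ∀ i ∈ I, C i *ᵥ (z + w) = C i *ᵥ w := fun i hi => by
    rw [Matrix.mulVec_add, mem_centerInter.mp hz i hi, zero_add]
  have hrepr : ∑ k, b.repr ⟨w, hw⟩ k • (b k : Fin s → ℂ) = w := by
    rw [hsum, b.sum_repr]
  rw [VanishesAt, heval, ← Matrix.exists_mulVec_eq_zero_iff]
  refine ⟨b.repr ⟨w, hw⟩, fun h0 => ?_, funext fun k => ?_⟩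
  · obtain ⟨i, hi⟩ := hI
    refine hX0 i ?_
    rw [hzw i hi, ← hrepr]
    simp [h0]
  · refine (map_eval_collinearityMatrix_mulVec C I (fun k => (b k : Fin s → ℂ))
      (fun i => (y i).rep) _ (f k)).trans ?_
    have hmem := hX (f k).1
    rw [hrepr, ← hzw _ (f k).1.2, Pi.zero_apply, sub_eq_zero]
    exact (mem_span_singleton_iff_mul_eq_mul (y _).rep_nonzero _).mp hmem _ _

/-! ### Points of the closure -/

/-- Degeneration step: a polynomial vanishing on the joint image vanishes at `v` as soon as some
`X ≠ 0` is mapped by every `C_i` to a multiple, possibly zero, of `v i`. If `C_i X = 0` for `i ∈ I`,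
moving `X` along the line `X + t Y` makes fewer images vanish, keeps the images `C_i (X + t Y)`,
`i ∈ I`, proportional to `v i` and moves the remaining ones continuously; so the value at `v` is a
limit of values that vanish by induction on the number of vanishing images. -/
theorem eval_eq_zero_of_mulVec_mem_span {n r s : ℕ} {C : Fin n → Matrix (Fin r) (Fin s) ℂ}
    (H : ∀ X ≠ 0, ∀ v : Fin n → Fin r → ℂ, (∀ i, v i ≠ 0) → (∃ i, C i *ᵥ X = 0) →
      ∃ Y, (∀ i, C i *ᵥ X = 0 → C i *ᵥ Y ∈ Submodule.span ℂ {v i}) ∧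
        ∃ i, C i *ᵥ X = 0 ∧ C i *ᵥ Y ≠ 0)
    {φ : MvPolynomial (Fin n × Fin r) ℂ} {d : Fin n → ℕ} (hφ : IsMultihomogeneous φ d)
    (hvan : ∀ y ∈ jointImage C, VanishesAt φ y)
    (X : Fin s → ℂ) (hX : X ≠ 0) (v : Fin n → Fin r → ℂ) (hv : ∀ i, v i ≠ 0)
    (hXv : ∀ i, C i *ᵥ X ∈ Submodule.span ℂ {v i}) :
    MvPolynomial.eval (fun p => v p.1 p.2) φ = 0 := by
  classical
  induction hm : (Finset.univ.filter fun i => C i *ᵥ X = 0).card using Nat.strong_induction_on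
    generalizing X v with
  | _ m ih =>
  by_cases hI : ∃ i, C i *ᵥ X = 0
  swap
  · push Not at hI
    exact (vanishesAt_iff hφ v hv).mp (hvan _ (mk_mem_jointImage hX hv hI hXv))
  obtain ⟨Y, hY, k, hk, hkY⟩ := H X hX v hv hI
  have hc : ∀ i, ∃ c : ℂ, c ≠ 0 ∧ (C i *ᵥ X ≠ 0 → C i *ᵥ X = c • v i) := fun i => by
    by_cases h : C i *ᵥ X = 0
    · exact ⟨1, one_ne_zero, fun h' => absurd h h'⟩
    · obtain ⟨c, hc, he⟩ := exists_ne_zero_smul_of_mem_span_singleton (hXv i) h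
      exact ⟨c, hc, fun _ => he⟩
  choose c hc0 hc using hc
  -- The line of `w t i` contains `C i *ᵥ (X + t • Y)`, and `w t i` tends to `v i`.
  let w : ℂ → Fin n → Fin r → ℂ := fun t i =>
    if C i *ᵥ X = 0 then v i else v i + t • (c i)⁻¹ • (C i *ᵥ Y)
  have hw0 : w 0 = v := by
    funext i
    simp [w]
  have hwc : Continuous w := by
    refine continuous_pi fun i => ?_
    by_cases h : C i *ᵥ X = 0
    · simp only [w, h, if_true]
      exact continuous_const
    · simp only [w, h, if_false]
      fun_prop
  have hCt : ∀ (t : ℂ) i, C i *ᵥ (X + t • Y) = C i *ᵥ X + t • (C i *ᵥ Y) := fun t i => by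
    rw [Matrix.mulVec_add, Matrix.mulVec_smul]
  have hCw : ∀ (t : ℂ) i, C i *ᵥ X ≠ 0 → C i *ᵥ (X + t • Y) = c i • w t i := fun t i h => by
    simp only [w, h, if_false]
    rw [hCt, smul_add, ← hc i h, smul_comm t, smul_inv_smul₀ (hc0 i)]
  have hwne : ∀ᶠ t in 𝓝[≠] (0 : ℂ), ∀ i, w t i ≠ 0 := by
    refine Filter.eventually_all.mpr fun i => ?_
    have hci : ContinuousAt (fun t => w t i) 0 := ((continuous_apply i).comp hwc).continuousAt
    exact (hci.eventually_ne (by simpa only [hw0] using hv i)).filter_mono nhdsWithin_le_nhds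
  have hzero : ∀ᶠ t in 𝓝[≠] (0 : ℂ), MvPolynomial.eval (fun p => w t p.1 p.2) φ = 0 := by
    filter_upwards [hwne, self_mem_nhdsWithin] with t ht ht0
    have hkt : C k *ᵥ (X + t • Y) ≠ 0 := by
      rw [hCt, hk, zero_add]
      exact smul_ne_zero ht0 hkY
    refine ih _ ?_ (X + t • Y) (fun h => hkt (by rw [h, Matrix.mulVec_zero])) (w t) ht
      (fun i => ?_) rfl
    · rw [← hm]
      refine Finset.card_lt_card (Finset.ssubset_iff_of_subset ?_ |>.mpr
        ⟨k, by simpa using hk, by simpa using hkt⟩)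
      intro i hi
      simp only [Finset.mem_filter, Finset.mem_univ, true_and] at hi ⊢
      by_contra h
      exact smul_ne_zero (hc0 i) (ht i) ((hCw t i h).symm.trans hi)
    · by_cases h : C i *ᵥ X = 0
      · rw [hCt, h, zero_add]
        simp only [w, h, if_true]
        exact Submodule.smul_mem _ _ (hY i h)
      · rw [hCw t i h]
        exact Submodule.smul_mem _ _ (Submodule.mem_span_singleton_self _)
  have hcont : Continuous fun t => MvPolynomial.eval (fun p => w t p.1 p.2) φ :=
    (MvPolynomial.continuous_eval φ).comp (continuous_pi fun p =>
      (continuous_apply p.2).comp ((continuous_apply p.1).comp hwc))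
  have hlim := hcont.continuousAt.tendsto.mono_left (nhdsWithin_le_nhds (a := 0) (s := {0}ᶜ))
  rw [hw0] at hlim
  exact tendsto_nhds_unique_of_eventuallyEq hlim tendsto_const_nhds hzero

theorem exists_of_mem_multiviewVariety {n r s : ℕ} (hn : 1 ≤ n)
    {C : Fin n → Matrix (Fin r) (Fin s) ℂ} {x : Fin n → ProjSpace r}
    (hx : x ∈ multiviewVariety C) :
    ∃ X ≠ 0, ∀ i, C i *ᵥ X ∈ Submodule.span ℂ {(x i).rep} := by
  obtain ⟨Y, hY, h⟩ := exists_notMem_centerInter_of_mem_multiviewVariety hx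
    (I := Finset.univ) ⟨⟨0, hn⟩, Finset.mem_univ _⟩
  exact ⟨Y, fun h0 => hY (h0 ▸ Submodule.zero_mem _), fun i => h i (Finset.mem_univ i)⟩

theorem multiviewVariety_eq {n r s : ℕ} (hn : 1 ≤ n) {C : Fin n → Matrix (Fin r) (Fin s) ℂ}
    (H : ∀ X ≠ 0, ∀ v : Fin n → Fin r → ℂ, (∀ i, v i ≠ 0) → (∃ i, C i *ᵥ X = 0) →
      ∃ Y, (∀ i, C i *ᵥ X = 0 → C i *ᵥ Y ∈ Submodule.span ℂ {v i}) ∧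
        ∃ i, C i *ᵥ X = 0 ∧ C i *ᵥ Y ≠ 0) :
    multiviewVariety C = {x | ∃ X ≠ 0, ∀ i, C i *ᵥ X ∈ Submodule.span ℂ {(x i).rep}} := by
  refine Set.Subset.antisymm (fun x hx => exists_of_mem_multiviewVariety hn hx) ?_
  rintro x ⟨X, hX, hXx⟩ φ d hφ hvan
  exact eval_eq_zero_of_mulVec_mem_span H hφ hvan X hX (fun i => (x i).rep)
    (fun i => (x i).rep_nonzero) hXx

/-! ### The rank conditions -/

theorem IsCamera.det_ne_zero {s : ℕ} {C : Matrix (Fin s) (Fin s) ℂ} (hC : IsCamera C) :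
    C.det ≠ 0 := by
  intro h
  obtain ⟨v, hv⟩ := Matrix.exists_mulVec_eq_zero_iff.mpr h
  have := C.rank_lt_card_iff.mpr ⟨v, hv⟩
  rw [IsCamera, min_self] at hC
  simp [hC] at this

theorem rank_invMatrix_le_one_iff {n s : ℕ} (hn : 1 ≤ n) {C : Fin n → Matrix (Fin s) (Fin s) ℂ}
    (hC : ∀ i, IsCamera (C i)) {v : Fin n → Fin s → ℂ} (hv : ∀ i, v i ≠ 0) :
    (invMatrix C v).rank ≤ 1 ↔ ∃ X ≠ 0, ∀ i, C i *ᵥ X ∈ Submodule.span ℂ {v i} := by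
  have hdet : ∀ i, IsUnit (C i).det := fun i => (hC i).det_ne_zero.isUnit
  have hinv : ∀ i u, C i *ᵥ ((C i)⁻¹ *ᵥ u) = u := fun i u => by
    rw [Matrix.mulVec_mulVec, Matrix.mul_nonsing_inv _ (hdet i), Matrix.one_mulVec]
  have hinv' : ∀ i u, (C i)⁻¹ *ᵥ (C i *ᵥ u) = u := fun i u => by
    rw [Matrix.mulVec_mulVec, Matrix.nonsing_inv_mul _ (hdet i), Matrix.one_mulVec]
  have hcol : (invMatrix C v).col = fun i => (C i)⁻¹ *ᵥ v i := rfl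
  rw [Matrix.rank_eq_finrank_span_cols, hcol]
  constructor
  · intro h
    have hne : (C ⟨0, hn⟩)⁻¹ *ᵥ v ⟨0, hn⟩ ≠ 0 := fun h0 => hv ⟨0, hn⟩ (by
      rw [← hinv ⟨0, hn⟩ (v ⟨0, hn⟩), h0, Matrix.mulVec_zero])
    refine ⟨_, hne, fun i => ?_⟩
    have hmem : ∀ j, (C j)⁻¹ *ᵥ v j ∈
        Submodule.span ℂ (Set.range fun i => (C i)⁻¹ *ᵥ v i) :=
      fun j => Submodule.subset_span ⟨j, rfl⟩
    obtain ⟨u, hu⟩ := finrank_le_one_iff.mp h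
    have hspan : ∀ j, (C j)⁻¹ *ᵥ v j ∈ Submodule.span ℂ {(u : Fin s → ℂ)} := fun j => by
      obtain ⟨c, hc⟩ := hu ⟨_, hmem j⟩
      exact Submodule.mem_span_singleton.mpr ⟨c, congrArg Subtype.val hc⟩
    have hine : (C i)⁻¹ *ᵥ v i ≠ 0 := fun h0 => hv i (by
      rw [← hinv i (v i), h0, Matrix.mulVec_zero])
    have hui := mem_span_singleton_symm (hspan i) hine
    obtain ⟨c, hc⟩ := Submodule.mem_span_singleton.mp
      (Submodule.mem_span_singleton_trans (hspan ⟨0, hn⟩) hui)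
    exact Submodule.mem_span_singleton.mpr ⟨c, by rw [← hc, Matrix.mulVec_smul, hinv]⟩
  · rintro ⟨X, hX, h⟩
    refine (Submodule.finrank_mono (Submodule.span_le.mpr ?_)).trans
      (finrank_span_singleton hX).le
    rintro _ ⟨i, rfl⟩
    have hne : C i *ᵥ X ≠ 0 := fun h0 => hX (by rw [← hinv' i X, h0, Matrix.mulVec_zero])
    obtain ⟨c, hc⟩ := Submodule.mem_span_singleton.mp (mem_span_singleton_symm (h i) hne)
    exact Submodule.mem_span_singleton.mpr ⟨c, by
      simp only
      rw [← hc, Matrix.mulVec_smul, hinv']⟩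

theorem rank_blockMatrix_lt_iff {n r s : ℕ} {C : Fin n → Matrix (Fin r) (Fin s) ℂ}
    {v : Fin n → Fin r → ℂ} (hv : ∀ i, v i ≠ 0) :
    (blockMatrix C v).rank < s + n ↔ ∃ X ≠ 0, ∀ i, C i *ᵥ X ∈ Submodule.span ℂ {v i} := by
  have hcard : Fintype.card (Fin s ⊕ Fin n) = s + n := by simp
  have hmul : ∀ w : Fin s ⊕ Fin n → ℂ, blockMatrix C v *ᵥ w = 0 ↔
      ∀ i, C i *ᵥ (w ∘ Sum.inl) + w (Sum.inr i) • v i = 0 := fun w => by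
    have hentry : ∀ i a, (blockMatrix C v *ᵥ w) (i, a) =
        (C i *ᵥ (w ∘ Sum.inl) + w (Sum.inr i) • v i) a := fun i a => by
      simp [blockMatrix, Matrix.mulVec, dotProduct, mul_comm]
    exact ⟨fun h i => funext fun a => (hentry i a).symm.trans (congrFun h _),
      fun h => funext fun p => (hentry p.1 p.2).trans (congrFun (h p.1) p.2)⟩
  rw [← hcard, Matrix.rank_lt_card_iff]
  constructor
  · rintro ⟨w, hw, h⟩
    rw [hmul] at h
    refine ⟨w ∘ Sum.inl, fun h0 => hw (funext ?_), fun i =>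
      Submodule.mem_span_singleton.mpr ⟨-w (Sum.inr i), ?_⟩⟩
    · rintro (j | i)
      · exact congrFun h0 j
      · have := h i
        rw [h0, Matrix.mulVec_zero, zero_add] at this
        exact (smul_eq_zero.mp this).resolve_right (hv i)
    · rw [neg_smul]
      exact (eq_neg_of_add_eq_zero_left (h i)).symm
  · rintro ⟨X, hX, h⟩
    choose c hc using fun i => Submodule.mem_span_singleton.mp (h i)
    refine ⟨Sum.elim X fun i => -c i, fun h0 => hX (funext fun j => congrFun h0 (Sum.inl j)), ?_⟩
    rw [hmul]
    intro i
    simp [hc]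

theorem rank_backMatrix_lt_iff {n s : ℕ} {C : Fin n → Matrix (Fin 2) (Fin s) ℂ}
    {v : Fin n → Fin 2 → ℂ} (hv : ∀ i, v i ≠ 0) :
    (backMatrix C v).rank < s ↔ ∃ X ≠ 0, ∀ i, C i *ᵥ X ∈ Submodule.span ℂ {v i} := by
  have hmul : ∀ X : Fin s → ℂ, (backMatrix C v)ᵀ *ᵥ X = 0 ↔
      ∀ i, C i *ᵥ X ∈ Submodule.span ℂ {v i} := fun X => by
    rw [funext_iff]
    refine forall_congr' fun i => ?_
    have hentry : ((backMatrix C v)ᵀ *ᵥ X) i =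
        v i 1 * (C i *ᵥ X) 0 - v i 0 * (C i *ᵥ X) 1 := by
      simp only [backMatrix, Matrix.mulVec, dotProduct, Matrix.transpose_apply, Matrix.of_apply,
        Fin.sum_univ_two, Finset.mul_sum, ← Finset.sum_sub_distrib]
      refine Finset.sum_congr rfl fun j _ => ?_
      simp
      ring
    rw [hentry, Pi.zero_apply, sub_eq_zero, mem_span_singleton_iff_mul_eq_mul (hv i)]
    simp only [Fin.forall_fin_two, true_and, and_true]
    exact ⟨fun h => ⟨h.symm, h⟩, fun h => h.2⟩
  rw [← Matrix.rank_transpose]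
  have h := (backMatrix C v)ᵀ.rank_lt_card_iff
  rw [Fintype.card_fin] at h
  simpa only [hmul] using h

/-! ### Generic hyperplane sections -/

theorem finrank_le_finrank_inf_comap_add {K E F : Type*} [Field K] [AddCommGroup E] [Module K E]
    [FiniteDimensional K E] [AddCommGroup F] [Module K F] [FiniteDimensional K F]
    (f : E →ₗ[K] F) (S : Submodule K F) (U : Submodule K E) :
    Module.finrank K U ≤
      Module.finrank K (U ⊓ S.comap f : Submodule K E) + Module.finrank K (F ⧸ S) := by
  let g := (S.mkQ ∘ₗ f).domRestrict U
  have hker : (LinearMap.ker g).map U.subtype = U ⊓ S.comap f := by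
    ext y
    simp [g, Submodule.mem_map, LinearMap.domRestrict_apply, and_comm]
  have h := g.finrank_range_add_finrank_ker
  rw [← hker, Submodule.finrank_map_subtype_eq]
  have := Submodule.finrank_le (LinearMap.range g)
  omega

theorem finrank_quotient_span_singleton {v : Fin 2 → ℂ} (hv : v ≠ 0) :
    Module.finrank ℂ ((Fin 2 → ℂ) ⧸ Submodule.span ℂ {v}) = 1 := by
  have h := Submodule.finrank_quotient_add_finrank (Submodule.span ℂ {v})
  rw [finrank_span_singleton hv, Module.finrank_fin_fun] at h
  omega

/-- Each condition `f_i y ∈ ℂ v_i` is a single linear equation. -/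
theorem finrank_le_finrank_inf_iInf_comap_add_card {ι E : Type*} [AddCommGroup E] [Module ℂ E]
    [FiniteDimensional ℂ E] (f : ι → E →ₗ[ℂ] (Fin 2 → ℂ)) {v : ι → Fin 2 → ℂ}
    (hv : ∀ i, v i ≠ 0) (R : Finset ι) :
    Module.finrank ℂ E ≤
      Module.finrank ℂ (⨅ i ∈ R, (Submodule.span ℂ {v i}).comap (f i) : Submodule ℂ E) +
        R.card := by
  classical
  induction R using Finset.induction_on with
  | empty =>
    have htop : ⨅ i ∈ (∅ : Finset ι), (Submodule.span ℂ {v i}).comap (f i) = ⊤ := by simp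
    rw [htop, finrank_top]
    exact Nat.le_add_right _ _
  | insert k R hk ih =>
    rw [Finset.card_insert_of_notMem hk, Finset.iInf_insert, inf_comm]
    have h := finrank_le_finrank_inf_comap_add (f k) (Submodule.span ℂ {v k})
      (⨅ i ∈ R, (Submodule.span ℂ {v i}).comap (f i))
    rw [finrank_quotient_span_singleton (hv k)] at h
    omega

/-- A form of Rado's theorem on independent transversals, with the functionals on `ℂ^2` given by
their kernels. If for every `J ⊆ R` the maps `f_i`, `i ∈ J`, have joint rank at least `|J|` on `U`,
then generic lines `ℂ v_i` in `ℂ^2` impose independent conditions `f_i y ∈ ℂ v_i` on `y ∈ U`. The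
line for `k` is chosen so that the condition is nontrivial on `U ⊓ ⨅ i ∈ J, ker f_i`
for all `J` for which `f_k` does not vanish there; this preserves the hypothesis. -/
theorem exists_finrank_inf_iInf_comap_add_card_le {ι E : Type*} [AddCommGroup E] [Module ℂ E]
    [FiniteDimensional ℂ E] (f : ι → E →ₗ[ℂ] (Fin 2 → ℂ)) (R : Finset ι) (U : Submodule ℂ E)
    (h : ∀ J ⊆ R, Module.finrank ℂ (U ⊓ ⨅ i ∈ J, LinearMap.ker (f i) : Submodule ℂ E) + J.card ≤
      Module.finrank ℂ U) :
    ∃ v : ι → Fin 2 → ℂ, (∀ i, v i ≠ 0) ∧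
      Module.finrank ℂ (U ⊓ ⨅ i ∈ R, (Submodule.span ℂ {v i}).comap (f i) : Submodule ℂ E) +
        R.card ≤ Module.finrank ℂ U := by
  classical
  induction R using Finset.induction_on generalizing U with
  | empty => exact ⟨fun _ _ => 1, fun _ h0 => one_ne_zero (congrFun h0 0),
      by simpa using Submodule.finrank_mono inf_le_left⟩
  | insert k R hk ih =>
    let T : Finset ι → Submodule ℂ E := fun J => U ⊓ ⨅ i ∈ J, LinearMap.ker (f i)
    let σ := {J : R.powerset // ∃ y ∈ T J, f k y ≠ 0}
    choose y hyT hy0 using fun J : σ => J.2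
    -- The case `J = ∅` makes the line of `k` cut `U` itself in a hyperplane.
    have hemp : ∃ y ∈ T ∅, f k y ≠ 0 := by
      by_contra! hU
      have hle : U ≤ U ⊓ ⨅ i ∈ ({k} : Finset ι), LinearMap.ker (f i) := fun y hy => by
        simpa using ⟨hy, hU y (by simpa [T] using hy)⟩
      have h1 := h {k} (by simp)
      have h2 := Submodule.finrank_mono hle
      rw [Finset.card_singleton] at h1
      omega
    obtain ⟨x, hx⟩ := Submodule.exists_forall_notMem_of_forall_ne_top
      (fun J : σ => Submodule.span ℂ {f k (y J)}) fun J htop => by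
        have := finrank_span_singleton (K := ℂ) (hy0 J)
        rw [htop, finrank_top, Module.finrank_fin_fun] at this
        omega
    have hx0 : x ≠ 0 := fun h0 =>
      hx ⟨⟨∅, Finset.empty_mem_powerset R⟩, hemp⟩ (by rw [h0]; exact Submodule.zero_mem _)
    let U' : Submodule ℂ E := U ⊓ (Submodule.span ℂ {x}).comap (f k)
    have hU' : Module.finrank ℂ U ≤ Module.finrank ℂ U' + 1 := by
      have := finrank_le_finrank_inf_comap_add (f k) (Submodule.span ℂ {x}) U
      rwa [finrank_quotient_span_singleton hx0] at this
    have hlt : ∀ J ⊆ R, (∃ y ∈ T J, f k y ≠ 0) →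
        Module.finrank ℂ (U' ⊓ ⨅ i ∈ J, LinearMap.ker (f i) : Submodule ℂ E) <
          Module.finrank ℂ (T J) := fun J hJ hex => by
      let j : σ := ⟨⟨J, Finset.mem_powerset.mpr hJ⟩, hex⟩
      refine Submodule.finrank_lt_finrank_of_lt (lt_of_le_of_ne
        (inf_le_inf_right _ inf_le_left) fun heq => hx j ?_)
      have hmem : y j ∈ U' ⊓ ⨅ i ∈ J, LinearMap.ker (f i) := heq ▸ hyT j
      exact mem_span_singleton_symm hmem.1.2 (hy0 j)
    obtain ⟨v, hv0, hv⟩ := ih U' fun J hJ => by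
      by_cases hex : ∃ y ∈ T J, f k y ≠ 0
      · have h1 := hlt J hJ hex
        have h2 := h J (hJ.trans (Finset.subset_insert k R))
        change Module.finrank ℂ (T J) + _ ≤ _ at h2
        omega
      · -- Here the condition for `k` is void on `T J`, which therefore equals `T (insert k J)`.
        push Not at hex
        have h1 := h (insert k J) (Finset.insert_subset_insert k hJ)
        rw [Finset.card_insert_of_notMem fun hkJ => hk (hJ hkJ)] at h1
        have hle : U' ⊓ ⨅ i ∈ J, LinearMap.ker (f i) ≤
            U ⊓ ⨅ i ∈ insert k J, LinearMap.ker (f i) := fun z hz => by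
          have hz' : z ∈ T J := ⟨hz.1.1, hz.2⟩
          rw [Finset.iInf_insert]
          exact ⟨hz.1.1, hex z hz', hz.2⟩
        have h2 := Submodule.finrank_mono hle
        omega
    refine ⟨Function.update v k x, fun i => ?_, ?_⟩
    · by_cases hik : i = k
      · subst hik
        simpa using hx0
      · simpa [hik] using hv0 i
    · have hcongr : ⨅ i ∈ R, (Submodule.span ℂ {Function.update v k x i}).comap (f i) =
          ⨅ i ∈ R, (Submodule.span ℂ {v i}).comap (f i) :=
        iInf_congr fun i => iInf_congr fun hi => by
          have hik : i ≠ k := fun hik => hk (hik ▸ hi)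
          rw [Function.update_of_ne hik]
      rw [Finset.iInf_insert, hcongr, Function.update_self, ← inf_assoc,
        Finset.card_insert_of_notMem hk]
      have h1 := hlt ∅ (Finset.empty_subset R) hemp
      have hinf : ∀ V : Submodule ℂ E, V ⊓ ⨅ i ∈ (∅ : Finset ι), LinearMap.ker (f i) = V := by simp
      rw [show T ∅ = U from hinf U, hinf U'] at h1
      change Module.finrank ℂ (U' ⊓ _ : Submodule ℂ E) + _ ≤ _
      omega

/-! ### Degenerate points -/

/-- If the variety contains every `x` such that some `X ≠ 0` has all `C_i X` in the lines `ℂ x_i`,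
then a nonzero `X ∈ c_I` gives points of it whose coordinates `x_i`, `i ∈ I`, are arbitrary, as
`C_i X = 0`; so the necessary condition for points of the closure holds for arbitrary `v i`. -/
theorem exists_notMem_centerInter_of_multiviewVariety_eq {n r s : ℕ}
    {C : Fin n → Matrix (Fin r) (Fin s) ℂ}
    (h : multiviewVariety C = {x | ∃ X ≠ 0, ∀ i, C i *ᵥ X ∈ Submodule.span ℂ {(x i).rep}})
    {I : Finset (Fin n)} (hI : I.Nonempty) (hc : centerInter C I ≠ ⊥)
    {v : Fin n → Fin r → ℂ} (hv : ∀ i, v i ≠ 0) :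
    ∃ Y ∉ centerInter C I, ∀ i ∈ I, C i *ᵥ Y ∈ Submodule.span ℂ {v i} := by
  obtain ⟨X, hXI, hX⟩ := (Submodule.ne_bot_iff _).mp hc
  have hrep : ∀ (u : Fin r → ℂ) (hu : u ≠ 0),
      Submodule.span ℂ {(Projectivization.mk ℂ u hu).rep} = Submodule.span ℂ {u} := fun u hu => by
    rw [← Projectivization.submodule_eq, Projectivization.submodule_mk]
  have hex : ∀ i, ∃ u ≠ 0, C i *ᵥ X ∈ Submodule.span ℂ {u} ∧ (i ∈ I → u = v i) := fun i => by
    by_cases h0 : C i *ᵥ X = 0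
    · exact ⟨v i, hv i, h0 ▸ Submodule.zero_mem _, fun _ => rfl⟩
    · exact ⟨_, h0, Submodule.mem_span_singleton_self _,
        fun hi => absurd (mem_centerInter.mp hXI i hi) h0⟩
  choose u hu0 hu huv using hex
  have hx : (fun i => Projectivization.mk ℂ (u i) (hu0 i)) ∈ multiviewVariety C := by
    rw [h]
    refine ⟨X, hX, fun i => ?_⟩
    rw [hrep]
    exact hu i
  obtain ⟨Y, hY, hYI⟩ := exists_notMem_centerInter_of_mem_multiviewVariety hx hI
  refine ⟨Y, hY, fun i hi => ?_⟩
  have := hYI i hi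
  rwa [hrep, huv i hi] at this

theorem IsCamera.finrank_center_add {r s : ℕ} {C : Matrix (Fin r) (Fin s) ℂ} (hC : IsCamera C) :
    Module.finrank ℂ (center C) + min r s = s := by
  have h := C.mulVecLin.finrank_range_add_finrank_ker
  rw [Module.finrank_fin_fun] at h
  change C.rank + Module.finrank ℂ (center C) = s at h
  rw [IsCamera] at hC
  omega

theorem IsCamera.mulVec_surjective {r s : ℕ} {C : Matrix (Fin r) (Fin s) ℂ} (hC : IsCamera C)
    (hrs : r ≤ s) : Function.Surjective C.mulVec := by
  have h : LinearMap.range C.mulVecLin = ⊤ := by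
    refine Submodule.eq_top_of_finrank_eq ?_
    rw [Module.finrank_fin_fun]
    exact hC.trans (min_eq_left hrs)
  exact LinearMap.range_eq_top.mp h

/-! ### The conditions on the centers -/

theorem multiviewVariety_eq_iff_center_ne {n N : ℕ} (hn : 1 ≤ n) (hN : 2 ≤ N)
    {C : Fin n → Matrix (Fin N) (Fin (N + 1)) ℂ} (hC : ∀ i, IsCamera (C i)) :
    multiviewVariety C = {x | ∃ X ≠ 0, ∀ i, C i *ᵥ X ∈ Submodule.span ℂ {(x i).rep}} ↔
      ∀ i j, i ≠ j → center (C i) ≠ center (C j) := by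
  classical
  have hdim : ∀ i, Module.finrank ℂ (center (C i)) = 1 := fun i => by
    have := (hC i).finrank_center_add
    rw [min_eq_left N.le_succ] at this
    omega
  constructor
  · intro h i j hij hcen
    obtain ⟨w, hw⟩ : ∃ w : Fin N → ℂ, w ≠ 0 :=
      ⟨fun _ => 1, fun h0 => one_ne_zero (congrFun h0 ⟨0, by omega⟩)⟩
    obtain ⟨Y₀, hY₀⟩ := (hC i).mulVec_surjective N.le_succ w
    obtain ⟨u, hu⟩ : ∃ u, u ∉ Submodule.span ℂ {C j *ᵥ Y₀} := by
      by_contra! hall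
      have hle := finrank_span_le_card (R := ℂ) {C j *ᵥ Y₀}
      rw [Set.toFinset_singleton, Finset.card_singleton,
        Submodule.eq_top_iff'.mpr hall, finrank_top, Module.finrank_fin_fun] at hle
      omega
    have hu0 : u ≠ 0 := fun h0 => hu (h0 ▸ Submodule.zero_mem _)
    have hcI : centerInter C {i, j} = center (C i) := by
      rw [centerInter, Finset.iInf_insert, Finset.iInf_singleton, ← hcen, inf_idem]
    -- `v i` is the image of `Y₀` under `C i`, but `v j` is not proportional to its image under
    -- `C j`.
    obtain ⟨Y, hY, hYI⟩ := exists_notMem_centerInter_of_multiviewVariety_eq h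
      (I := {i, j}) (v := Function.update (fun _ => u) i w) ⟨i, by simp⟩
      (fun h0 => by
        have := hdim i
        rw [← hcI, h0, finrank_bot] at this
        omega)
      (fun k => by
        by_cases hk : k = i
        · subst hk
          simpa using hw
        · simpa [hk] using hu0)
    have hYi := hYI i (by simp)
    have hYj := hYI j (by simp)
    rw [Function.update_self, ← hY₀] at hYi
    rw [Function.update_of_ne hij.symm] at hYj
    rw [hcI] at hY
    obtain ⟨c, hc⟩ := Submodule.mem_span_singleton.mp hYi
    -- `Y` and `c • Y₀` differ by an element of the common center, so `C j` does not separate them.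
    have hdiff : Y - c • Y₀ ∈ center (C j) := by
      rw [← hcen, mem_center, Matrix.mulVec_sub, Matrix.mulVec_smul, hc, sub_self]
    rw [mem_center, Matrix.mulVec_sub, Matrix.mulVec_smul, sub_eq_zero] at hdiff
    have hYj0 : C j *ᵥ Y ≠ 0 := by
      rw [hcen, mem_center] at hY
      exact hY
    exact hu (Submodule.mem_span_singleton_trans (mem_span_singleton_symm hYj hYj0)
      (Submodule.mem_span_singleton.mpr ⟨c, hdiff.symm⟩))
  · intro h
    refine multiviewVariety_eq hn fun X hX v hv ⟨i, hi⟩ => ?_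
    obtain ⟨Y, hY⟩ := (hC i).mulVec_surjective N.le_succ (v i)
    have hspan : ∀ j, C j *ᵥ X = 0 → Submodule.span ℂ {X} = center (C j) := fun j hj =>
      Submodule.eq_of_le_of_finrank_eq
        ((Submodule.span_singleton_le_iff_mem _ _).mpr (mem_center.mpr hj))
        ((finrank_span_singleton hX).trans (hdim j).symm)
    refine ⟨Y, fun j hj => ?_, i, hi, hY ▸ hv i⟩
    obtain rfl : j = i := by
      by_contra hji
      exact h j i hji ((hspan j hj).symm.trans (hspan i hi))
    exact hY ▸ Submodule.mem_span_singleton_self _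

theorem projDim_le_iff {s : ℕ} (N k : ℕ) (W : Submodule ℂ (Fin s → ℂ)) :
    (N : ℤ) - (k : ℤ) - 1 ≥ projDim W ↔ Module.finrank ℂ W + k ≤ N := by
  rw [projDim]
  omega

theorem multiviewVariety_eq_iff_finrank_centerInter {n N : ℕ} (hn : 1 ≤ n)
    {C : Fin n → Matrix (Fin 2) (Fin (N + 1)) ℂ} (hC : ∀ i, IsCamera (C i)) :
    multiviewVariety C = {x | ∃ X ≠ 0, ∀ i, C i *ᵥ X ∈ Submodule.span ℂ {(x i).rep}} ↔
      ∀ I : Finset (Fin n), I.Nonempty → centerInter C I ≠ ⊥ →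
        Module.finrank ℂ (centerInter C I) + I.card ≤ N := by
  classical
  constructor
  · intro h I
    -- A minimal violating `I` satisfies the rank conditions for an independent transversal.
    induction I using Finset.strongInduction with
    | H I ih =>
    intro hI hc
    by_contra! hcard
    have hanti : ∀ J ⊆ I, centerInter C I ≤ centerInter C J := fun J hJ X hX =>
      mem_centerInter.mpr fun i hi => mem_centerInter.mp hX i (hJ hi)
    have hproper : ∀ J ⊂ I, J.Nonempty →
        Module.finrank ℂ (centerInter C J) + J.card ≤ N := fun J hJ hne =>
      ih J hJ hne fun h0 => hc (le_bot_iff.mp (h0 ▸ hanti J hJ.subset))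
    obtain ⟨v, hv0, hv⟩ := exists_finrank_inf_iInf_comap_add_card_le
      (fun i => (C i).mulVecLin) I ⊤ fun J hJ => by
        rw [top_inf_eq, finrank_top, Module.finrank_fin_fun]
        change Module.finrank ℂ (centerInter C J) + _ ≤ _
        rcases J.eq_empty_or_nonempty with rfl | hne
        · simpa using Submodule.finrank_le (centerInter C ∅)
        rcases hJ.eq_or_ssubset with rfl | hss
        swap
        · exact (hproper J hss hne).trans N.le_succ
        obtain ⟨k, hk⟩ := hne
        have hcardk := Finset.card_erase_add_one hk
        rcases (J.erase k).eq_empty_or_nonempty with he | hne'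
        · have hle : centerInter C J ≤ center (C k) := fun X hX =>
            mem_center.mpr (mem_centerInter.mp hX k hk)
          have h1 := Submodule.finrank_mono hle
          have h2 := (hC k).finrank_center_add
          rw [he, Finset.card_empty] at hcardk
          omega
        · have h1 := hproper _ (Finset.erase_ssubset hk) hne'
          have h2 := Submodule.finrank_mono (hanti _ (J.erase_subset k))
          omega
    rw [top_inf_eq, finrank_top, Module.finrank_fin_fun] at hv
    have hle : centerInter C I ≤
        ⨅ i ∈ I, (Submodule.span ℂ {v i}).comap (C i).mulVecLin := by
      refine iInf₂_mono fun i _ X hX => ?_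
      rw [mem_center] at hX
      simp [hX]
    -- By dimension, only the elements of `c_I` are compatible with the lines `ℂ v_i`.
    have heq := Submodule.eq_of_le_of_finrank_le hle (by omega)
    obtain ⟨Y, hY, hYI⟩ := exists_notMem_centerInter_of_multiviewVariety_eq h hI hc hv0
    rw [heq] at hY
    exact hY (by simpa [Submodule.mem_iInf] using hYI)
  · intro h
    refine multiviewVariety_eq hn fun X hX v hv hi => ?_
    let I := Finset.univ.filter fun i => C i *ᵥ X = 0
    have hI : I.Nonempty := by
      obtain ⟨i, hi⟩ := hi
      exact ⟨i, by simpa [I] using hi⟩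
    have hXI : X ∈ centerInter C I := mem_centerInter.mpr fun i hi => by simpa [I] using hi
    have h1 := h I hI fun h0 => hX (by simpa [h0] using hXI)
    have h2 := finrank_le_finrank_inf_iInf_comap_add_card (fun i => (C i).mulVecLin) hv I
    rw [Module.finrank_fin_fun] at h2
    obtain ⟨Y, hYS, hY⟩ := SetLike.not_le_iff_exists.mp fun hle :
        (⨅ i ∈ I, (Submodule.span ℂ {v i}).comap (C i).mulVecLin) ≤ centerInter C I => by
      have := Submodule.finrank_mono hle
      omega
    rw [mem_centerInter] at hY
    push Not at hY
    obtain ⟨i, hi, hiY⟩ := hY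
    refine ⟨Y, fun j hj => ?_, i, by simpa [I] using hi, hiY⟩
    simp only [Submodule.mem_iInf, Submodule.mem_comap, Matrix.mulVecLin_apply] at hYS
    exact hYS j (by simpa [I] using hj)

/-- Cameras to `ℙ^0` have a nonempty joint image in the one-point space `(ℙ^0)^n`. -/
theorem multiviewVariety_eq_univ {n s : ℕ} {C : Fin n → Matrix (Fin 1) (Fin (s + 1)) ℂ}
    (hC : ∀ i, IsCamera (C i)) : multiviewVariety C = Set.univ := by
  obtain ⟨X, hX⟩ := Submodule.exists_forall_notMem_of_forall_ne_top
    (fun o : Option (Fin n) => o.elim ⊥ fun i => center (C i)) fun o htop => by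
      rcases o with _ | i
      · exact bot_ne_top htop
      · have h := (hC i).finrank_center_add
        change center (C i) = ⊤ at htop
        rw [htop, finrank_top, Module.finrank_fin_fun] at h
        omega
  have hX0 : X ≠ 0 := fun h0 => hX none (by simp [h0])
  have hCX : ∀ i, C i *ᵥ X ≠ 0 := fun i h0 => hX (some i) (mem_center.mpr h0)
  have hmem := mk_mem_jointImage hX0 hCX hCX fun i => Submodule.mem_span_singleton_self _
  have hsub : Subsingleton (ProjSpace 1) := ⟨fun p q => by
    rw [← p.mk_rep, ← q.mk_rep, Projectivization.mk_eq_mk_iff']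
    have hq : q.rep 0 ≠ 0 := fun h0 => q.rep_nonzero (funext fun a => by
      rw [Subsingleton.elim a 0, h0, Pi.zero_apply])
    refine ⟨p.rep 0 / q.rep 0, funext fun a => ?_⟩
    rw [Subsingleton.elim a 0, Pi.smul_apply, smul_eq_mul, div_mul_cancel₀ _ hq]⟩
  refine Set.eq_univ_of_forall fun x φ d _ hvan => ?_
  rw [Subsingleton.elim x]
  exact hvan _ hmem

theorem mainTheorem3 (n : ℕ) (hn : 1 ≤ n) :
    -- (P1)
    (∀ (N : ℕ) (C : Fin n → Matrix (Fin (N + 1)) (Fin (N + 1)) ℂ), (∀ i, IsCamera (C i)) →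
      multiviewVariety C = {x | (invMatrix C (fun i => (x i).rep)).rank ≤ 1}) ∧
    -- (P2)
    (∀ (N : ℕ) (C : Fin n → Matrix (Fin N) (Fin (N + 1)) ℂ), (∀ i, IsCamera (C i)) →
      (2 ≤ N →
        (multiviewVariety C = {x | (blockMatrix C (fun i => (x i).rep)).rank ≤ N + n} ↔
          ∀ i j, i ≠ j → center (C i) ≠ center (C j))) ∧
      (N = 1 →
        multiviewVariety C = {x | (blockMatrix C (fun i => (x i).rep)).rank ≤ N + n})) ∧
    -- (P3)
    (∀ (N : ℕ) (C : Fin n → Matrix (Fin 2) (Fin (N + 1)) ℂ), (∀ i, IsCamera (C i)) →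
      (multiviewVariety C = {x | (backMatrix C (fun i => (x i).rep)).rank ≤ N} ↔
        ∀ I : Finset (Fin n), I.Nonempty → centerInter C I ≠ ⊥ →
          (N : ℤ) - (I.card : ℤ) - 1 ≥ projDim (centerInter C I))) := by
  refine ⟨fun N C hC => ?_, fun N C hC => ?_, fun N C hC => ?_⟩
  · have hset : {x : Fin n → ProjSpace (N + 1) | (invMatrix C fun i => (x i).rep).rank ≤ 1} =
        {x | ∃ X ≠ 0, ∀ i, C i *ᵥ X ∈ Submodule.span ℂ {(x i).rep}} :=
      Set.ext fun x => rank_invMatrix_le_one_iff hn hC fun i => (x i).rep_nonzero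
    rw [hset]
    refine multiviewVariety_eq hn fun X hX _ _ ⟨i, hi⟩ => ?_
    exact absurd (Matrix.exists_mulVec_eq_zero_iff.mp ⟨X, hX, hi⟩) (hC i).det_ne_zero
  · have hset : {x : Fin n → ProjSpace N | (blockMatrix C fun i => (x i).rep).rank ≤ N + n} =
        {x | ∃ X ≠ 0, ∀ i, C i *ᵥ X ∈ Submodule.span ℂ {(x i).rep}} :=
      Set.ext fun x => by
        rw [Set.mem_ofPred_eq, Set.mem_ofPred_eq,
          ← rank_blockMatrix_lt_iff fun i => (x i).rep_nonzero]
        omega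
    rw [hset]
    refine ⟨fun hN => multiviewVariety_eq_iff_center_ne hn hN hC, fun hN => ?_⟩
    subst hN
    refine Set.Subset.antisymm (fun x hx => exists_of_mem_multiviewVariety hn hx) ?_
    rw [multiviewVariety_eq_univ hC]
    exact Set.subset_univ _
  · have hset : {x : Fin n → ProjSpace 2 | (backMatrix C fun i => (x i).rep).rank ≤ N} =
        {x | ∃ X ≠ 0, ∀ i, C i *ᵥ X ∈ Submodule.span ℂ {(x i).rep}} :=
      Set.ext fun x => by
        rw [Set.mem_ofPred_eq, Set.mem_ofPred_eq,
          ← rank_backMatrix_lt_iff fun i => (x i).rep_nonzero, Nat.lt_succ_iff]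
    rw [hset, multiviewVariety_eq_iff_finrank_centerInter hn hC]
    simp only [projDim_le_iff]
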